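/- Let $G=(V,E)$ be a finite connected multigraph (parallel edges allowed) without loops and without bridges, with $n=|V|\ge 1$ vertices. For $A\subseteq E$ let $c(A)$ be the number of connected components of the spanning subgraph $(V,A)$, $\rho(A)=n-c(A)$ and $\gamma(A)=|A|-n+c(A)$, and let $$T(G;x,y)=\sum_{A\subseteq E}(x-1)^{\rho(E)-\rho(A)}(y-1)^{\gamma(A)}=\sum_{i,j}t_{i,j}\,x^iy^j$$ be the Tutte polynomial of $G$, where $t_{i,j}=0$ if $i<0$ or $j<0$. A parallel class of a graph is a nonempty maximal set of edges that all have the same endvertices; it is nontrivial if it contains more than one edge. Let $p(G)$ and $p^*(G)$ be the numbers of parallel classes and of nontrivial parallel classes of $G$, respectively. Let $\Delta(\tilde G)$ be the number of triangles of the simple graph $\tilde G$ obtained from $G$ by replacing each parallel class by a single edge, and let $G/A$ be the graph obtained from $G$ by contracting all edges in $A$. Then 1. $t_{n-1,0}=1$; 2. $t_{n-2,0}=p(G)-n+1$; 3. $t_{n-3,0}=\binom{n-1}{2}-(n-2)\,p(G)+\binom{p(G)}{2}-\Delta(\tilde G)$; 4. $t_{n-2,1}=p^*(G)$; 5. $t_{n-3,1}=-p^*(G)(n-2)+\sum_{A}p(G/A)+\Delta(\tilde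 G)$, where the sum is over the nontrivial parallel classes $A\subseteq E$ of $G$. -/

import Mathlib

/-!
Multigraphs are Mathlib's `Graph α β`: a vertex set in `α`, an edge set in `β`, loops and parallel
edges allowed.
-/

noncomputable section

namespace Graph

variable {α β : Type*}

/-- The vertex set of the connected component of `G` that contains `x` (for a vertex `x` of `G`):
all `y` that can be reached from `x` along edges of `G`. -/
def component (G : Graph α β) (x : α) : Set α :=
  {y | Relation.ReflTransGen G.Adj x y}

/-- `c(G)`: the number of connected components of a (finite) multigraph. -/
def numComponents (G : Graph α β) : ℕ :=
  (G.component '' G.vertexSet).ncard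

/-- A multigraph is connected if it has a vertex and any two vertices are joined by a walk. -/
def IsConnected (G : Graph α β) : Prop :=
  G.vertexSet.Nonempty ∧ ∀ x ∈ G.vertexSet, ∀ y ∈ G.vertexSet, y ∈ G.component x

/-- A bridge: an edge whose deletion increases the number of connected components. -/
def IsBridge (G : Graph α β) (e : β) : Prop :=
  e ∈ G.edgeSet ∧ G.numComponents < (G.deleteEdges {e}).numComponents

/-- A multigraph without bridges. -/
def Bridgeless (G : Graph α β) : Prop :=
  ∀ e, ¬ G.IsBridge e

/-- The contraction `G / A`: delete the edges in `A` and identify the vertices in each connected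
component of the spanning subgraph `(V, A)`. The vertices of `G / A` are the vertex sets of
these components. -/
def contract (G : Graph α β) (A : Set β) : Graph (Set α) β :=
  (G.deleteEdges A).map (G.restrict A).component

/-- The rank `ρ(A) = n - c(A)`, where `c(A)` is the number of components of the spanning subgraph
`(V, A)`. The subtraction does not truncate for finite `V`, as `c(A) ≤ n`. -/
def edgeRank (G : Graph α β) (A : Set β) : ℕ :=
  G.vertexSet.ncard - (G.restrict A).numComponents

/-- The nullity `γ(A) = |A| - ρ(A) = |A| - n + c(A)`. The subtraction does not truncate for finite
`A` and `V`, as `ρ(A) ≤ |A|`. -/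
def edgeNullity (G : Graph α β) (A : Set β) : ℕ :=
  A.ncard - G.edgeRank A

open Polynomial in
/-- The Tutte polynomial of a finite multigraph,
`T(G; x, y) = ∑_{A ⊆ E} (x - 1)^(ρ(E) - ρ(A)) (y - 1)^γ(A)`,
as a polynomial in `y` (the outer variable) over polynomials in `x` (the inner variable). -/
def tuttePoly (G : Graph α β) : ℤ[X][X] :=
  ∑ᶠ A ∈ {A : Set β | A ⊆ G.edgeSet},
    (C X - 1) ^ (G.edgeRank G.edgeSet - G.edgeRank A) * (X - 1) ^ G.edgeNullity A

/-- `t_{i,j}`: the coefficient of `x ^ i * y ^ j` in the Tutte polynomial, for integers `i` and `j`;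
it is `0` if an exponent is negative. -/
def tutteCoeff (G : Graph α β) (i j : ℤ) : ℤ :=
  if 0 ≤ i ∧ 0 ≤ j then (G.tuttePoly.coeff j.toNat).coeff i.toNat else 0

/-- The parallel classes of `G`: for each pair of adjacent vertices `x`, `y`, the set of all edges
with ends `x` and `y`. -/
def parallelClasses (G : Graph α β) : Set (Set β) :=
  {A | ∃ x y, G.Adj x y ∧ A = {e | G.IsLink e x y}}

/-- The parallel classes that contain more than one edge. -/
def nontrivialParallelClasses (G : Graph α β) : Set (Set β) :=
  {A | A ∈ G.parallelClasses ∧ A.Nontrivial}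

/-- `p(G)`: the number of parallel classes. -/
def numParallelClasses (G : Graph α β) : ℕ :=
  G.parallelClasses.ncard

/-- `p*(G)`: the number of nontrivial parallel classes. -/
def numNontrivialParallelClasses (G : Graph α β) : ℕ :=
  G.nontrivialParallelClasses.ncard

/-- `Δ(G̃)`: the number of triangles of the underlying simple graph, in which each parallel
class of `G` is replaced by a single edge. -/
def numTriangles (G : Graph α β) : ℕ :=
  (G.toSimpleGraph.cliqueSet 3).ncard

end Graph

end

/-!
The exponent of `x - 1` in the summand of an edge set `A` is the corank of `A`. Hence, if
`r = n - 1` is the rank of `G`, the coefficient of `x ^ (r - k) * y ^ j` only involves edge sets of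
rank at most `k`, and for `k ≤ 2` these can be listed.

The rank of `A` depends only on the set `K` of unordered pairs that are joined by some edge in `A`.
So the parallel classes of `G` are replaced by the set `D` of pairs of ends of edges, the edge set
of the underlying simple graph. The edge sets `A` that realize exactly the pairs in `K` arise by
choosing a nonempty subset of each of the parallel classes, so that, with `m d` the number of edges
in the class `d`,
`∑ (y - 1) ^ (|A| - ρ(A)) = (y - 1) ^ (|K| - ρ(K)) * ∏ d ∈ K, (1 + y + ⋯ + y ^ (m d - 1))`
(`sum_image_eq_X_sub_one_pow`). The product has constant term `1`, and its linear coefficient is the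
number of nontrivial classes in `K`.

In a simple graph the only set of rank `0` is the empty one, the sets of rank `1` are the
singletons, and the sets of rank `2` are the sets of two edges and the triangles
(`pairRank_eq_two_iff`). Summing over these sets gives all coefficients in question in terms of
`p(G)`, `p*(G)`, the number of triangles, and, for rank `2` and the linear coefficient in `y`, the
numbers of triangles through each nontrivial class. The latter are eliminated by the observation
that contracting a class `d` merges two other classes precisely if they form a triangle with `d`, so
that `p(G / d)` is `p(G) - 1` minus the number of triangles through `d`
(`Graph.IsEndsMap.numParallelClasses_contract`).

If `n - 1 < k`, the coefficient is zero by convention. The formulas persist: there are no sets of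
rank `k`, so the sum over them that appears on the right is zero, and the terms from lower ranks
vanish as well.
-/

open Finset

/-! ### Connectivity and rank of sets of pairs -/

/-- `x` and `y` are joined by a walk all of whose steps are pairs in `K`. Vertices are all elements
of `α`; those outside all pairs in `K` are isolated. -/
def PairConn {α : Type*} (K : Set (Sym2 α)) : α → α → Prop :=
  Relation.ReflTransGen fun a b => s(a, b) ∈ K

/-- The connected component of `x` in the graph with edge set `K`. -/
def pairComp {α : Type*} (K : Set (Sym2 α)) (x : α) : Set α :=
  {y | PairConn K x y}

/-- The number of components of the graph with vertex set `V` and edge set `K`. -/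
noncomputable def pairComps {α : Type*} (V : Set α) (K : Set (Sym2 α)) : ℕ :=
  (pairComp K '' V).ncard

/-- The rank of the edge set `K` in the graphic matroid on the vertex set `V`. The subtraction does
not truncate for finite `V`. -/
noncomputable def pairRank {α : Type*} (V : Set α) (K : Set (Sym2 α)) : ℕ :=
  V.ncard - pairComps V K

section Connectivity

variable {α : Type*} {K L : Set (Sym2 α)} {V : Set α} {u v x y : α}

lemma PairConn.symm (h : PairConn K x y) : PairConn K y x := by
  have : Std.Symm fun a b => s(a, b) ∈ K := ⟨fun a b hab => by rwa [Sym2.eq_swap]⟩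
  exact Relation.ReflTransGen.stdSymm.symm _ _ h

lemma PairConn.mono (hKL : K ⊆ L) (h : PairConn K x y) : PairConn L x y :=
  Relation.ReflTransGen.mono (p := fun a b => s(a, b) ∈ L) (fun _ _ hab => hKL hab) _ _ h

lemma pairConn_insert_iff :
    PairConn (insert s(u, v) K) x y ↔
      PairConn K x y ∨ (PairConn K x u ∧ PairConn K v y) ∨ (PairConn K x v ∧ PairConn K u y) := by
  constructor
  · intro h
    induction h with
    | refl => exact Or.inl .refl
    | @tail b c _ hbc ih =>
      rcases hbc with hbc | hbc
      · rw [Sym2.eq_iff] at hbc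
        have hr : ∀ z, PairConn K z z := fun z => .refl
        rcases hbc with ⟨rfl, rfl⟩ | ⟨rfl, rfl⟩
        · rcases ih with ih | ih | ih
          · exact Or.inr (Or.inl ⟨ih, hr _⟩)
          · exact Or.inr (Or.inl ⟨ih.1, hr _⟩)
          · exact Or.inl ih.1
        · rcases ih with ih | ih | ih
          · exact Or.inr (Or.inr ⟨ih, hr _⟩)
          · exact Or.inl ih.1
          · exact Or.inr (Or.inr ⟨ih.1, hr _⟩)
      · have hs : PairConn K b c := .single hbc
        rcases ih with ih | ih | ih
        · exact Or.inl (ih.trans hs)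
        · exact Or.inr (Or.inl ⟨ih.1, ih.2.trans hs⟩)
        · exact Or.inr (Or.inr ⟨ih.1, ih.2.trans hs⟩)
  · have hm : ∀ {a b}, PairConn K a b → PairConn (insert s(u, v) K) a b :=
      fun h => h.mono (Set.subset_insert _ _)
    have huv : PairConn (insert s(u, v) K) u v := .single (Set.mem_insert _ _)
    rintro (h | ⟨h, h'⟩ | ⟨h, h'⟩)
    · exact hm h
    · exact ((hm h).trans huv).trans (hm h')
    · exact ((hm h).trans huv.symm).trans (hm h')

lemma pairConn_empty_iff : PairConn (∅ : Set (Sym2 α)) x y ↔ x = y := by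
  constructor
  · intro h
    induction h with
    | refl => rfl
    | tail _ h => exact h.elim
  · rintro rfl
    exact .refl

lemma pairConn_singleton_iff :
    PairConn {s(u, v)} x y ↔ x = y ∨ (x = u ∧ v = y) ∨ (x = v ∧ u = y) := by
  have h := @pairConn_insert_iff α ∅ u v x y
  simpa only [pairConn_empty_iff, insert_empty_eq] using h

lemma pairComp_eq_iff : pairComp K x = pairComp K y ↔ PairConn K x y := by
  constructor
  · intro h
    have : y ∈ pairComp K y := .refl
    rwa [← h] at this
  · intro h
    ext z
    exact ⟨fun hz => h.symm.trans hz, fun hz => h.trans hz⟩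

lemma pairComps_le (hV : V.Finite) : pairComps V K ≤ V.ncard :=
  Set.ncard_image_le hV

lemma pairComps_anti (hV : V.Finite) (hKL : K ⊆ L) : pairComps V L ≤ pairComps V K := by
  have h : pairComp L '' V = (fun C => ⋃ z ∈ C, pairComp L z) '' (pairComp K '' V) := by
    rw [Set.image_image]
    refine Set.image_congr fun x _ => ?_
    ext y
    simp only [Set.mem_iUnion, exists_prop]
    exact ⟨fun hy => ⟨x, .refl, hy⟩,
      fun ⟨z, hz, hy⟩ => (PairConn.mono hKL hz).trans hy⟩
  rw [pairComps, pairComps, h]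
  exact Set.ncard_image_le (hV.image _)

lemma pairComps_empty : pairComps V (∅ : Set (Sym2 α)) = V.ncard := by
  refine Set.ncard_image_of_injective _ fun x y h => ?_
  exact pairConn_empty_iff.1 (pairComp_eq_iff.1 h)

lemma pairComps_insert_of_conn (h : PairConn K u v) :
    pairComps V (insert s(u, v) K) = pairComps V K := by
  have : pairComp (insert s(u, v) K) = pairComp K := by
    ext x y
    refine pairConn_insert_iff.trans ⟨?_, Or.inl⟩
    rintro (hxy | ⟨h₁, h₂⟩ | ⟨h₁, h₂⟩)
    · exact hxy
    · exact (h₁.trans h).trans h₂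
    · exact (h₁.trans h.symm).trans h₂
  rw [pairComps, pairComps, this]

lemma pairComps_insert_of_not_conn (hV : V.Finite) (hu : u ∈ V) (hv : v ∈ V)
    (h : ¬ PairConn K u v) : pairComps V (insert s(u, v) K) + 1 = pairComps V K := by
  classical
  -- Passing from `K` to `insert s(u, v) K` replaces the components of `u` and `v` by their union.
  set φ : Set α → Set α := fun C =>
    if C = pairComp K u ∨ C = pairComp K v then pairComp K u ∪ pairComp K v else C with hφ
  have hne : pairComp K u ≠ pairComp K v := fun hE => h (pairComp_eq_iff.1 hE)
  have himg : pairComp (insert s(u, v) K) '' V = φ '' (pairComp K '' V) := by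
    rw [Set.image_image]
    refine Set.image_congr fun x _ => ?_
    ext y
    simp only [hφ, pairComp_eq_iff]
    change PairConn _ x y ↔ _
    rw [pairConn_insert_iff]
    split_ifs with hx
    · simp only [Set.mem_union]
      change _ ↔ PairConn K u y ∨ PairConn K v y
      rcases hx with hx | hx
      · have h₁ : ¬ PairConn K x v := fun h' => h (hx.symm.trans h')
        have h₂ : PairConn K x y ↔ PairConn K u y :=
          ⟨fun h' => hx.symm.trans h', fun h' => hx.trans h'⟩
        tauto
      · have h₁ : ¬ PairConn K x u := fun h' => h (h'.symm.trans hx)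
        have h₂ : PairConn K x y ↔ PairConn K v y :=
          ⟨fun h' => hx.symm.trans h', fun h' => hx.trans h'⟩
        tauto
    · change _ ↔ PairConn K x y
      tauto
  have hmem : ∀ w ∈ V, pairComp K w ∈ pairComp K '' V := fun w hw => ⟨w, hw, rfl⟩
  have himg' : φ '' (pairComp K '' V) = φ '' ((pairComp K '' V) \ {pairComp K v}) := by
    refine Set.Subset.antisymm ?_ (Set.image_mono Set.sdiff_subset)
    rintro _ ⟨C, hC, rfl⟩
    by_cases hCv : C = pairComp K v
    · refine ⟨pairComp K u, ⟨hmem u hu, hne⟩, ?_⟩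
      simp [hφ, hCv]
    · exact ⟨C, ⟨hC, hCv⟩, rfl⟩
  have hinj : Set.InjOn φ ((pairComp K '' V) \ {pairComp K v}) := by
    have key : ∀ x, pairComp K u ∪ pairComp K v ≠ pairComp K x := by
      intro x hx
      have h₁ : PairConn K x u := by
        change u ∈ pairComp K x
        rw [← hx]; exact Or.inl .refl
      have h₂ : PairConn K x v := by
        change v ∈ pairComp K x
        rw [← hx]; exact Or.inr .refl
      exact h (h₁.symm.trans h₂)
    rintro _ ⟨⟨x, hx, rfl⟩, hxv⟩ _ ⟨⟨y, hy, rfl⟩, hyv⟩ hxy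
    simp only [Set.mem_singleton_iff] at hxv hyv
    simp only [hφ, hxv, hyv, or_false] at hxy
    split_ifs at hxy with h₁ h₂ h₂
    · rw [h₁, h₂]
    · exact (key _ hxy).elim
    · exact (key _ hxy.symm).elim
    · exact hxy
  rw [pairComps, pairComps, himg, himg', hinj.ncard_image]
  exact Set.ncard_sdiff_singleton_add_one (hmem v hv) (hV.image _)

end Connectivity

/-! ### Sets of small rank in a simple graph -/

section Rank

variable {α : Type*} {K L : Set (Sym2 α)} {V : Set α} {u v x y : α}

lemma pairRank_mono (hV : V.Finite) (hKL : K ⊆ L) : pairRank V K ≤ pairRank V L :=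
  Nat.sub_le_sub_left (pairComps_anti hV hKL) _

lemma pairRank_empty : pairRank V (∅ : Set (Sym2 α)) = 0 := by
  rw [pairRank, pairComps_empty, Nat.sub_self]

lemma pairRank_insert_of_conn (h : PairConn K u v) :
    pairRank V (insert s(u, v) K) = pairRank V K := by
  rw [pairRank, pairComps_insert_of_conn h, pairRank]

lemma pairRank_insert_of_not_conn (hV : V.Finite) (hu : u ∈ V) (hv : v ∈ V)
    (h : ¬ PairConn K u v) : pairRank V (insert s(u, v) K) = pairRank V K + 1 := by
  have h₁ := pairComps_insert_of_not_conn hV hu hv h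
  have h₂ := pairComps_le (K := K) hV
  unfold pairRank
  omega

lemma pairRank_singleton (hV : V.Finite) (hu : u ∈ V) (hv : v ∈ V) (huv : u ≠ v) :
    pairRank V {s(u, v)} = 1 := by
  rw [← insert_empty_eq, pairRank_insert_of_not_conn hV hu hv (by rwa [pairConn_empty_iff]),
    pairRank_empty]

/-- Every member of `K` is a pair of two distinct elements of `V`: `K` is the edge set of a simple
graph on `V`. -/
def IsPairSet (V : Set α) (K : Set (Sym2 α)) : Prop :=
  ∀ a b, s(a, b) ∈ K → a ∈ V ∧ b ∈ V ∧ a ≠ b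

lemma pairRank_pair (hV : V.Finite) {d e : Sym2 α} (hK : IsPairSet V {d, e}) (hde : d ≠ e) :
    pairRank V {d, e} = 2 := by
  induction d with | _ u v =>
  induction e with | _ x y =>
  obtain ⟨hu, hv, huv⟩ := hK u v (by simp)
  obtain ⟨hx, hy, hxy⟩ := hK x y (by simp)
  rw [pairRank_insert_of_not_conn hV hu hv, pairRank_singleton hV hx hy hxy]
  rw [pairConn_singleton_iff]
  rw [Ne, Sym2.eq_iff] at hde
  grind

/-- A set of pairs that consists of the three edges of a triangle. -/
def IsTriangle [DecidableEq α] (K : Finset (Sym2 α)) : Prop :=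
  ∃ a b c, a ≠ b ∧ a ≠ c ∧ b ≠ c ∧ K = {s(a, b), s(a, c), s(b, c)}

lemma IsTriangle.card_eq [DecidableEq α] {K : Finset (Sym2 α)} (h : IsTriangle K) :
    #K = 3 := by
  obtain ⟨a, b, c, hab, hac, hbc, rfl⟩ := h
  rw [Finset.card_eq_three]
  refine ⟨_, _, _, ?_, ?_, ?_, rfl⟩ <;> rw [Ne, Sym2.eq_iff] <;> grind

lemma IsTriangle.pairRank_eq [DecidableEq α] {K : Finset (Sym2 α)} (h : IsTriangle K)
    (hV : V.Finite) (hK : IsPairSet V K) : pairRank V K = 2 := by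
  have h3 := h.card_eq
  obtain ⟨a, b, c, hab, hac, hbc, rfl⟩ := h
  push_cast at hK ⊢
  rw [pairRank_insert_of_conn, pairRank_pair hV]
  · intro x y hxy
    exact hK x y (Set.mem_insert_of_mem _ hxy)
  · rw [Ne, Sym2.eq_iff]; grind
  · have h₁ : PairConn {s(a, c), s(b, c)} a c := .single (by simp)
    have h₂ : PairConn {s(a, c), s(b, c)} b c := .single (by simp)
    exact h₁.trans h₂.symm

/-- A pair whose ends are connected by two other pairs forms a triangle with them. -/
lemma isTriangle_of_pairConn [DecidableEq α] {d e : Sym2 α} (hd : ¬ d.IsDiag) (he : ¬ e.IsDiag)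
    (hde : d ≠ e) (huv : u ≠ v) (hdf : d ≠ s(u, v)) (hef : e ≠ s(u, v))
    (h : PairConn {d, e} u v) : IsTriangle {s(u, v), d, e} := by
  induction d with | _ a b =>
  induction e with | _ x y =>
  simp only [Sym2.mk_isDiag_iff] at hd he
  rw [pairConn_insert_iff] at h
  simp only [pairConn_singleton_iff] at h
  simp only [Ne, Sym2.eq_iff] at hde hdf hef
  -- The two pairs share exactly one vertex `w`, and join it to `u` and to `v`.
  have key : ∃ w, w ≠ u ∧ w ≠ v ∧
      ((s(a, b) = s(u, w) ∧ s(x, y) = s(v, w)) ∨ (s(a, b) = s(v, w) ∧ s(x, y) = s(u, w))) := by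
    simp only [Sym2.eq_iff]
    by_cases hau : a = u
    · exact ⟨b, by grind⟩
    · by_cases hav : a = v
      · exact ⟨b, by grind⟩
      · exact ⟨a, by grind⟩
  obtain ⟨w, hwu, hwv, ⟨h₁, h₂⟩ | ⟨h₁, h₂⟩⟩ := key
  · rw [h₁, h₂]
    exact ⟨u, v, w, huv, hwu.symm, hwv.symm, rfl⟩
  · rw [h₁, h₂]
    exact ⟨u, v, w, huv, hwu.symm, hwv.symm, by rw [Finset.pair_comm]⟩

lemma IsPairSet.mono (hL : IsPairSet V L) (hKL : K ⊆ L) : IsPairSet V K :=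
  fun a b h => hL a b (hKL h)

lemma IsPairSet.not_isDiag (hK : IsPairSet V K) {d : Sym2 α} (hd : d ∈ K) : ¬ d.IsDiag := by
  induction d with | _ u v =>
  exact (hK u v hd).2.2

lemma pairRank_triple [DecidableEq α] (hV : V.Finite) {d e f : Sym2 α}
    (hK : IsPairSet V {f, d, e}) (hde : d ≠ e) (hdf : d ≠ f) (hef : e ≠ f)
    (h : ¬ IsTriangle {f, d, e}) : pairRank V {f, d, e} = 3 := by
  have hK' : IsPairSet V {d, e} := hK.mono (Set.subset_insert _ _)
  induction f with | _ u v =>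
  obtain ⟨hu, hv, huv⟩ := hK u v (by simp)
  rw [pairRank_insert_of_not_conn hV hu hv, pairRank_pair hV hK' hde]
  exact fun hc => h (isTriangle_of_pairConn (hK'.not_isDiag (by simp))
    (hK'.not_isDiag (by simp)) hde huv hdf hef hc)

lemma pairRank_le_card [DecidableEq α] (hV : V.Finite) (K : Finset (Sym2 α))
    (hK : IsPairSet V K) : pairRank V K ≤ #K := by
  induction K using Finset.induction_on with
  | empty => simp [pairRank_empty]
  | insert d K hd ih =>
    have ih := ih (hK.mono (by simp))
    rw [Finset.card_insert_of_notMem hd]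
    push_cast at hK ⊢
    induction d with | _ u v =>
    obtain ⟨hu, hv, huv⟩ := hK u v (by simp)
    by_cases h : PairConn (K : Set (Sym2 α)) u v
    · rw [pairRank_insert_of_conn h]; omega
    · rw [pairRank_insert_of_not_conn hV hu hv h]; omega

/-- Two distinct pairs lie in at most one triangle. -/
lemma IsTriangle.eq_of_mem [DecidableEq α] {d e f g : Sym2 α} (hde : d ≠ e)
    (hf : IsTriangle {f, d, e}) (hg : IsTriangle {g, d, e}) : f = g := by
  have hf3 := hf.card_eq
  have hg3 := hg.card_eq
  have aux : ∀ {f d e : Sym2 α}, #{f, d, e} = 3 → f ≠ d ∧ f ≠ e := by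
    intro f d e h
    constructor <;> rintro rfl
    · have : #({f, f, e} : Finset (Sym2 α)) ≤ 2 := by
        rw [Finset.insert_idem]; exact Finset.card_le_two
      omega
    · have : #({f, d, f} : Finset (Sym2 α)) ≤ 2 := by
        rw [Finset.insert_eq_of_mem (by simp)]; exact Finset.card_le_two
      omega
  have hf' := aux hf3
  have hg' := aux hg3
  -- In a triangle `f, d, e`, the ends of `f` are the ends of `d` and `e` that these do not share.
  have desc : ∀ {f d e : Sym2 α}, f ≠ d → f ≠ e → d ≠ e → IsTriangle {f, d, e} →
      ∃ u v w, f = s(u, v) ∧ d = s(u, w) ∧ e = s(v, w) ∧ u ≠ v ∧ u ≠ w ∧ v ≠ w := by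
    intro f d e hfd hfe hde h
    obtain ⟨a, b, c, hab, hac, hbc, h⟩ := h
    have h1 : f ∈ ({s(a, b), s(a, c), s(b, c)} : Finset (Sym2 α)) := h ▸ (by simp)
    have h2 : d ∈ ({s(a, b), s(a, c), s(b, c)} : Finset (Sym2 α)) := h ▸ (by simp)
    have h3 : e ∈ ({s(a, b), s(a, c), s(b, c)} : Finset (Sym2 α)) := h ▸ (by simp)
    simp only [Finset.mem_insert, Finset.mem_singleton] at h1 h2 h3
    have s1 := @Sym2.eq_swap α a b
    have s2 := @Sym2.eq_swap α a c
    have s3 := @Sym2.eq_swap α b c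
    rcases h1 with rfl | rfl | rfl <;> rcases h2 with rfl | rfl | rfl <;>
      rcases h3 with rfl | rfl | rfl <;>
      try first
        | exact (hfd rfl).elim
        | exact (hfe rfl).elim
        | exact (hde rfl).elim
    · exact ⟨a, b, c, rfl, rfl, rfl, hab, hac, hbc⟩
    · exact ⟨b, a, c, s1, rfl, rfl, hab.symm, hbc, hac⟩
    · exact ⟨a, c, b, rfl, rfl, s3, hac, hab, hbc.symm⟩
    · exact ⟨c, a, b, s2, s3, rfl, hac.symm, hbc.symm, hab⟩
    · exact ⟨b, c, a, rfl, s1, s2, hbc, hab.symm, hac.symm⟩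
    · exact ⟨c, b, a, s3, s2, s1, hbc.symm, hac.symm, hab.symm⟩
  obtain ⟨u, v, w, rfl, hd, he, h1, h2, h3⟩ := desc hf'.1 hf'.2 hde hf
  obtain ⟨u', v', w', rfl, hd', he', h1', h2', h3'⟩ := desc hg'.1 hg'.2 hde hg
  rw [hd, Sym2.eq_iff] at hd'
  rw [he, Sym2.eq_iff] at he'
  rw [Sym2.eq_iff]
  grind

/-- A set of at least three edges that is not a triangle contains three edges that do not form a
triangle, and thus a forest with three edges. -/
lemma three_le_pairRank [DecidableEq α] (hV : V.Finite) {K : Finset (Sym2 α)}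
    (hK : IsPairSet V K) (h3 : 3 ≤ #K) (hT : ¬ IsTriangle K) : 3 ≤ pairRank V K := by
  have main : ∃ d e f, d ≠ e ∧ d ≠ f ∧ e ≠ f ∧ {f, d, e} ⊆ K ∧ ¬ IsTriangle {f, d, e} := by
    obtain ⟨f, hf, d, hd, e, he, hfd, hfe, hde⟩ := Finset.two_lt_card.1 h3
    have hsub : ∀ g ∈ K, ({g, d, e} : Finset (Sym2 α)) ⊆ K := by
      intro g hg z hz
      simp only [Finset.mem_insert, Finset.mem_singleton] at hz
      rcases hz with rfl | rfl | rfl <;> assumption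
    -- Two distinct triples that contain `d` and `e` are not both triangles.
    by_cases hfde : IsTriangle {f, d, e}
    · have hne : ({f, d, e} : Finset (Sym2 α)) ≠ K := fun h => hT (h ▸ hfde)
      obtain ⟨g, hg, hg'⟩ := Finset.exists_of_ssubset ((hsub f hf).ssubset_of_ne hne)
      simp only [Finset.mem_insert, Finset.mem_singleton, not_or] at hg'
      exact ⟨d, e, g, hde, Ne.symm hg'.2.1, Ne.symm hg'.2.2, hsub g hg,
        fun h => hg'.1 (h.eq_of_mem hde hfde)⟩
    · exact ⟨d, e, f, hde, hfd.symm, hfe.symm, hsub f hf, hfde⟩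
  obtain ⟨d, e, f, hde, hdf, hef, hsub, hnt⟩ := main
  have hsub' : ({f, d, e} : Set (Sym2 α)) ⊆ K := by
    have := Finset.coe_subset.2 hsub
    push_cast at this
    exact this
  rw [← pairRank_triple hV (hK.mono hsub') hde hdf hef hnt]
  exact pairRank_mono hV hsub'

lemma pairRank_eq_zero_iff [DecidableEq α] (hV : V.Finite) {K : Finset (Sym2 α)}
    (hK : IsPairSet V K) : pairRank V K = 0 ↔ K = ∅ := by
  constructor
  · intro h
    by_contra hne
    obtain ⟨d, hd⟩ := Finset.nonempty_iff_ne_empty.2 hne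
    have := pairRank_mono (V := V) (K := {d}) (L := K) hV (by simpa using hd)
    induction d with | _ u v =>
    obtain ⟨hu, hv, huv⟩ := hK u v hd
    rw [pairRank_singleton hV hu hv huv] at this
    omega
  · rintro rfl
    simp [pairRank_empty]

lemma two_le_pairRank [DecidableEq α] (hV : V.Finite) {K : Finset (Sym2 α)}
    (hK : IsPairSet V K) (h : 2 ≤ #K) : 2 ≤ pairRank V K := by
  obtain ⟨d, hd, e, he, hde⟩ := Finset.one_lt_card.1 h
  have hsub : ({d, e} : Set (Sym2 α)) ⊆ K := by
    rintro z (rfl | rfl) <;> assumption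
  rw [← pairRank_pair hV (hK.mono hsub) hde]
  exact pairRank_mono hV hsub

lemma pairRank_eq_one_iff [DecidableEq α] (hV : V.Finite) {K : Finset (Sym2 α)}
    (hK : IsPairSet V K) : pairRank V K = 1 ↔ #K = 1 := by
  have h0 := pairRank_eq_zero_iff hV hK
  have h2 := two_le_pairRank hV hK
  have hle := pairRank_le_card hV K hK
  rw [← Finset.card_eq_zero] at h0
  omega

lemma pairRank_eq_two_iff [DecidableEq α] (hV : V.Finite) {K : Finset (Sym2 α)}
    (hK : IsPairSet V K) : pairRank V K = 2 ↔ #K = 2 ∨ IsTriangle K := by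
  have h2 := two_le_pairRank hV hK
  have h3 := three_le_pairRank hV hK
  have hle := pairRank_le_card hV K hK
  have hT := fun h : IsTriangle K => h.pairRank_eq hV hK
  by_cases h : IsTriangle K
  · simp [h, hT h]
  · simp only [h, not_false_eq_true, or_false, forall_const] at h3 ⊢
    omega

end Rank

/-! ### Rank generating sums -/

section SubsetSums

open Polynomial

variable {β κ : Type*} [DecidableEq β] [DecidableEq κ]

lemma sum_nonempty_subsets_X_sub_one_pow (P : Finset β) :
    ∑ B ∈ P.powerset with B.Nonempty, (X - 1 : ℤ[X]) ^ (#B - 1) = ∑ i ∈ range #P, X ^ i := by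
  have hX : (X - 1 : ℤ[X]) ≠ 0 := by
    simpa using X_sub_C_ne_zero (1 : ℤ)
  refine mul_left_cancel₀ hX ?_
  rw [mul_geom_sum, mul_sum]
  have h := Finset.sum_pow_mul_eq_add_pow (X - 1 : ℤ[X]) 1 P
  simp only [one_pow, mul_one, sub_add_cancel] at h
  have hf : P.powerset.filter (fun B => B.Nonempty) = P.powerset.erase ∅ := by
    ext B
    simp [Finset.nonempty_iff_ne_empty, and_comm]
  rw [← h, ← Finset.add_sum_erase _ _ (Finset.empty_mem_powerset P), hf]
  simp only [Finset.card_empty, pow_zero, add_sub_cancel_left]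
  refine Finset.sum_congr rfl fun B hB => ?_
  have : #B ≠ 0 := by simpa using (Finset.mem_erase.1 hB).1
  rw [← pow_succ', Nat.sub_add_cancel (by omega)]

/-- The edge sets that meet exactly the fibres of `f` over `K` arise by choosing a nonempty subset
of each of these fibres independently. -/
lemma sum_image_eq_X_sub_one_pow (E : Finset β) (f : β → κ) (K : Finset κ) :
    ∑ A ∈ E.powerset with A.image f = K, (X - 1 : ℤ[X]) ^ (#A - #K) =
      ∏ d ∈ K, ∑ i ∈ range #{e ∈ E | f e = d}, X ^ i := by
  induction K using Finset.induction_on with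
  | empty =>
    have : E.powerset.filter (fun A => A.image f = ∅) = {∅} := by
      ext A
      simp only [Finset.mem_filter, Finset.image_eq_empty, Finset.mem_singleton]
      exact ⟨fun h => h.2, fun h => ⟨h ▸ Finset.empty_mem_powerset _, h⟩⟩
    rw [this]
    simp
  | insert d K hd ih =>
    rw [Finset.prod_insert hd, ← ih, ← sum_nonempty_subsets_X_sub_one_pow, Finset.sum_mul_sum,
      ← Finset.sum_product']
    refine Finset.sum_nbij' (fun A => ({e ∈ A | f e = d}, {e ∈ A | f e ≠ d}))
      (fun p => p.1 ∪ p.2) ?_ ?_ ?_ ?_ ?_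
    · intro A hA
      simp only [Finset.mem_filter, Finset.mem_powerset, Finset.mem_product] at hA ⊢
      obtain ⟨hAE, hAi⟩ := hA
      refine ⟨⟨Finset.filter_subset_filter _ hAE, ?_⟩, (Finset.filter_subset _ _).trans hAE, ?_⟩
      · have : d ∈ A.image f := hAi ▸ Finset.mem_insert_self d K
        obtain ⟨e, he, hed⟩ := Finset.mem_image.1 this
        exact ⟨e, by simp [he, hed]⟩
      · ext c
        have : c ∈ A.image f ↔ c ∈ insert d K := by rw [hAi]
        simp only [Finset.mem_image, Finset.mem_insert, Finset.mem_filter] at this ⊢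
        grind
    · rintro ⟨B, A⟩ hp
      simp only [Finset.mem_filter, Finset.mem_powerset, Finset.mem_product] at hp ⊢
      obtain ⟨⟨hB, hBn⟩, hA, hAi⟩ := hp
      refine ⟨Finset.union_subset (hB.trans (Finset.filter_subset _ _)) hA, ?_⟩
      have : B.image f = {d} := by
        ext c
        simp only [Finset.mem_image, Finset.mem_singleton]
        constructor
        · rintro ⟨e, he, rfl⟩
          exact (Finset.mem_filter.1 (hB he)).2
        · rintro rfl
          obtain ⟨e, he⟩ := hBn
          exact ⟨e, he, (Finset.mem_filter.1 (hB he)).2⟩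
      rw [Finset.image_union, this, hAi, Finset.singleton_union]
    · intro A _
      exact Finset.filter_union_filter_not_eq _ A
    · rintro ⟨B, A⟩ hp
      simp only [Finset.mem_filter, Finset.mem_powerset, Finset.mem_product] at hp
      obtain ⟨⟨hB, hBn⟩, hA, hAi⟩ := hp
      have h₁ : ∀ e ∈ B, f e = d := fun e he => (Finset.mem_filter.1 (hB he)).2
      have h₂ : ∀ e ∈ A, f e ≠ d := fun e he h =>
        hd (hAi ▸ h ▸ Finset.mem_image_of_mem f he)
      ext e <;> simp only [Finset.mem_filter, Finset.mem_union] <;> grind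
    · intro A hA
      simp only [Finset.mem_filter, Finset.mem_powerset] at hA
      obtain ⟨hAE, hAi⟩ := hA
      have hc := Finset.card_filter_add_card_filter_not (s := A) (fun e => f e = d)
      have h1 : 1 ≤ #{e ∈ A | f e = d} := by
        have : d ∈ A.image f := hAi ▸ Finset.mem_insert_self d K
        obtain ⟨e, he, hed⟩ := Finset.mem_image.1 this
        exact Finset.card_pos.2 ⟨e, by simp [he, hed]⟩
      have h2 : #K ≤ #{e ∈ A | f e ≠ d} := by
        refine le_trans (Finset.card_le_card ?_) (Finset.card_image_le (f := f))
        intro c hc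
        have : c ∈ A.image f := hAi ▸ Finset.mem_insert_of_mem hc
        obtain ⟨e, he, rfl⟩ := Finset.mem_image.1 this
        exact Finset.mem_image_of_mem f
          (Finset.mem_filter.2 ⟨he, fun h => hd (h ▸ hc)⟩)
      rw [Finset.card_insert_of_notMem hd, ← pow_add]
      congr 1
      simp only [ne_eq] at h2 ⊢
      omega

/-- A rank generating sum over the subsets of `E` whose rank only depends on the fibres of `f`
that are met reduces to a sum over sets of fibres. -/
lemma sum_powerset_eq_sum_powerset_image (E : Finset β) (f : β → κ) (rk : Finset κ → ℕ)
    (hrk : ∀ K ⊆ E.image f, rk K ≤ #K) (g : ℕ → ℤ) (j : ℕ) :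
    ∑ A ∈ E.powerset,
        g (rk (A.image f)) * ((X - 1 : ℤ[X]) ^ (#A - rk (A.image f))).coeff j =
      ∑ K ∈ (E.image f).powerset, g (rk K) *
        ((X - 1 : ℤ[X]) ^ (#K - rk K) *
          ∏ d ∈ K, ∑ i ∈ range #{e ∈ E | f e = d}, X ^ i).coeff j := by
  have hm : ∀ A ∈ E.powerset, A.image f ∈ (E.image f).powerset := fun A hA =>
    Finset.mem_powerset.2 (Finset.image_subset_image (Finset.mem_powerset.1 hA))
  rw [← Finset.sum_fiberwise_of_maps_to hm]
  refine Finset.sum_congr rfl fun K hK => ?_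
  rw [← sum_image_eq_X_sub_one_pow, Finset.mul_sum, finsetSum_coeff, Finset.mul_sum]
  refine Finset.sum_congr rfl fun A hA => ?_
  obtain ⟨-, rfl⟩ := Finset.mem_filter.1 hA
  rw [← pow_add]
  have h₁ := hrk _ (Finset.mem_powerset.1 hK)
  have h₂ := Finset.card_image_le (s := A) (f := f)
  congr 4
  omega

lemma coeff_X_sub_one_pow_sub {r k l : ℕ} (hk : k ≤ r) (hl : l ≤ k) :
    ((X - 1 : ℤ[X]) ^ (r - l)).coeff (r - k) = (-1) ^ (k - l) * ((r - l).choose (k - l) : ℤ) := by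
  have h := coeff_X_add_C_pow (-1 : ℤ) (r - l) (r - k)
  rw [C_neg, C_1, ← sub_eq_add_neg] at h
  rw [h]
  have h1 : r - l - (r - k) = k - l := by omega
  have h2 : (r - l).choose (r - k) = (r - l).choose (k - l) := by
    rw [← Nat.choose_symm (by omega : k - l ≤ r - l)]
    congr 1
    omega
  rw [h1, h2]

/-- The coefficient of `x ^ (r - k)` in a rank generating sum only involves sets of rank
at most `k`. -/
lemma sum_coeff_mul_eq_sum_range {τ : Type*} (s : Finset τ) (rk : τ → ℕ) (r k : ℕ) (hk : k ≤ r)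
    (hr : ∀ K ∈ s, rk K ≤ r) (w : τ → ℤ) :
    ∑ K ∈ s, ((X - 1 : ℤ[X]) ^ (r - rk K)).coeff (r - k) * w K =
      ∑ l ∈ range (k + 1), (-1) ^ (k - l) * ((r - l).choose (k - l) : ℤ) *
        ∑ K ∈ s with rk K = l, w K := by
  have h0 : ∀ K ∈ s, ((X - 1 : ℤ[X]) ^ (r - rk K)).coeff (r - k) * w K ≠ 0 → rk K < k + 1 := by
    intro K hK h
    by_contra hlt
    refine h ?_
    rw [coeff_eq_zero_of_natDegree_lt, zero_mul]
    have hd : (X - 1 : ℤ[X]).natDegree = 1 := by simpa using natDegree_X_sub_C (1 : ℤ)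
    refine lt_of_le_of_lt natDegree_pow_le ?_
    have := hr K hK
    rw [hd]
    omega
  rw [← Finset.sum_filter_of_ne h0]
  have hm : ∀ K ∈ s.filter (fun K => rk K < k + 1), rk K ∈ range (k + 1) := by simp
  rw [← Finset.sum_fiberwise_of_maps_to hm]
  refine Finset.sum_congr rfl fun l hl => ?_
  rw [Finset.mem_range] at hl
  rw [Finset.mul_sum, Finset.filter_filter]
  refine Finset.sum_congr ?_ fun K hK => ?_
  · ext K; simp only [Finset.mem_filter]
    constructor
    · rintro ⟨h, _, h'⟩; exact ⟨h, h'⟩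
    · rintro ⟨h, rfl⟩; exact ⟨h, hl, rfl⟩
  · rw [(Finset.mem_filter.1 hK).2, coeff_X_sub_one_pow_sub hk (by omega)]

end SubsetSums

/-! ### Sums over sets of rank at most two -/

section SmallRank

open Polynomial

variable {κ : Type*}

lemma coeff_zero_prod_eq_one (S : κ → ℤ[X]) (K : Finset κ) (hS : ∀ d ∈ K, (S d).coeff 0 = 1) :
    (∏ d ∈ K, S d).coeff 0 = 1 := by
  rw [coeff_zero_prod]
  exact Finset.prod_eq_one hS

lemma coeff_one_prod_eq_sum [DecidableEq κ] (S : κ → ℤ[X]) (K : Finset κ)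
    (hS : ∀ d ∈ K, (S d).coeff 0 = 1) :
    (∏ d ∈ K, S d).coeff 1 = ∑ d ∈ K, (S d).coeff 1 := by
  induction K using Finset.induction_on with
  | empty => simp [coeff_one]
  | insert d K hd ih =>
    have hS' : ∀ d ∈ K, (S d).coeff 0 = 1 := fun e he => hS e (Finset.mem_insert_of_mem he)
    rw [Finset.prod_insert hd, Finset.sum_insert hd, mul_coeff_one, ih hS',
      coeff_zero_prod_eq_one S K hS', hS d (Finset.mem_insert_self d K)]
    ring

lemma sum_powersetCard_two_sum [DecidableEq κ] (D : Finset κ) (s : κ → ℤ) :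
    ∑ K ∈ D.powersetCard 2, ∑ d ∈ K, s d = ∑ d ∈ D, s d * ((#D : ℤ) - 1) := by
  rw [Finset.sum_comm' (t' := D) (s' := fun d => {K ∈ D.powersetCard 2 | d ∈ K})]
  · refine Finset.sum_congr rfl fun d hd => ?_
    have h : {K ∈ D.powersetCard 2 | d ∈ K} = (D.erase d).image fun e => {d, e} := by
      ext K
      simp only [Finset.mem_filter, Finset.mem_powersetCard, Finset.mem_image, Finset.mem_erase]
      constructor
      · rintro ⟨⟨hK, h2⟩, hdK⟩
        obtain ⟨a, b, hab, rfl⟩ := Finset.card_eq_two.1 h2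
        simp only [Finset.mem_insert, Finset.mem_singleton] at hdK
        rcases hdK with rfl | rfl
        · exact ⟨b, ⟨hab.symm, hK (by simp)⟩, rfl⟩
        · exact ⟨a, ⟨hab, hK (by simp)⟩, Finset.pair_comm _ _⟩
      · rintro ⟨e, ⟨hed, he⟩, rfl⟩
        refine ⟨⟨?_, Finset.card_pair hed.symm⟩, by simp⟩
        intro z hz
        simp only [Finset.mem_insert, Finset.mem_singleton] at hz
        rcases hz with rfl | rfl <;> assumption
    have hinj : Set.InjOn (fun e => ({d, e} : Finset κ)) (D.erase d) := by
      intro a ha b hb hab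
      have hab : ({d, a} : Finset κ) = {d, b} := hab
      have : a ∈ ({d, b} : Finset κ) := hab ▸ by simp
      have had : a ≠ d := (Finset.mem_erase.1 ha).1
      simpa [had] using this
    rw [Finset.sum_const, h, Finset.card_image_of_injOn hinj, Finset.card_erase_of_mem hd,
      nsmul_eq_mul, Nat.cast_sub (Finset.card_pos.2 ⟨d, hd⟩)]
    push_cast
    ring
  · intro K d
    simp only [Finset.mem_filter, Finset.mem_powersetCard]
    constructor
    · rintro ⟨⟨hK, h2⟩, hd⟩
      exact ⟨⟨⟨hK, h2⟩, hd⟩, hK hd⟩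
    · rintro ⟨h, -⟩
      exact h

open Classical in
/-- The triangles in a set of pairs. -/
noncomputable def triangles {α : Type*} (D : Finset (Sym2 α)) : Finset (Finset (Sym2 α)) :=
  {K ∈ D.powerset | IsTriangle K}

variable {α : Type*} {V : Set α} {D : Finset (Sym2 α)} (S : Sym2 α → ℤ[X])

lemma mem_triangles [DecidableEq α] {K : Finset (Sym2 α)} :
    K ∈ triangles D ↔ K ⊆ D ∧ IsTriangle K := by
  classical
  refine Finset.mem_filter.trans ?_
  rw [Finset.mem_powerset]
  convert Iff.rfl

lemma sum_pairRank_eq_zero (hV : V.Finite) (hD : IsPairSet V D) (j : ℕ) :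
    ∑ K ∈ D.powerset.filter (fun K : Finset (Sym2 α) => pairRank V K = 0),
      ((X - 1 : ℤ[X]) ^ (#K - pairRank V ↑K) * ∏ d ∈ K, S d).coeff j = if j = 0 then 1 else 0 := by
  classical
  have : D.powerset.filter (fun K : Finset (Sym2 α) => pairRank V K = 0) = {∅} := by
    ext K
    simp only [Finset.mem_filter, Finset.mem_powerset, Finset.mem_singleton]
    constructor
    · rintro ⟨hK, h⟩
      exact (pairRank_eq_zero_iff hV (hD.mono hK)).1 h
    · rintro rfl
      simp [pairRank_empty]
  rw [this, Finset.sum_singleton]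
  simp [coeff_one]

lemma sum_pairRank_eq_one (hV : V.Finite) (hD : IsPairSet V D) (j : ℕ) :
    ∑ K ∈ D.powerset.filter (fun K : Finset (Sym2 α) => pairRank V K = 1),
      ((X - 1 : ℤ[X]) ^ (#K - pairRank V ↑K) * ∏ d ∈ K, S d).coeff j =
      ∑ d ∈ D, (S d).coeff j := by
  classical
  have h : D.powerset.filter (fun K : Finset (Sym2 α) => pairRank V K = 1) = D.powersetCard 1 := by
    ext K
    simp only [Finset.mem_filter, Finset.mem_powerset, Finset.mem_powersetCard]
    exact and_congr_right fun hK => pairRank_eq_one_iff hV (hD.mono hK)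
  have h' : ∀ K ∈ D.powersetCard 1,
      ((X - 1 : ℤ[X]) ^ (#K - pairRank V ↑K) * ∏ d ∈ K, S d).coeff j =
        (∏ d ∈ K, S d).coeff j := by
    intro K hK
    rw [← h, Finset.mem_filter] at hK
    obtain ⟨hK, h1⟩ := hK
    have := (pairRank_eq_one_iff hV (hD.mono (Finset.mem_powerset.1 hK))).1 h1
    rw [h1, this, Nat.sub_self, pow_zero, one_mul]
  rw [h, Finset.sum_congr rfl h', Finset.powersetCard_one, Finset.sum_map]
  simp

/-- Rank two sets are pairs of edges and triangles; a triangle contributes with an additional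
factor `y - 1`. -/
lemma sum_pairRank_eq_two (hV : V.Finite) (hD : IsPairSet V D) (j : ℕ) :
    ∑ K ∈ D.powerset.filter (fun K : Finset (Sym2 α) => pairRank V K = 2),
      ((X - 1 : ℤ[X]) ^ (#K - pairRank V ↑K) * ∏ d ∈ K, S d).coeff j =
      ∑ K ∈ D.powersetCard 2, (∏ d ∈ K, S d).coeff j +
        ∑ K ∈ triangles D, ((X - 1) * ∏ d ∈ K, S d).coeff j := by
  classical
  have h : D.powerset.filter (fun K : Finset (Sym2 α) => pairRank V K = 2) =
      D.powersetCard 2 ∪ triangles D := by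
    ext K
    simp only [Finset.mem_filter, Finset.mem_powerset, Finset.mem_powersetCard, mem_triangles,
      Finset.mem_union, ← and_or_left]
    exact and_congr_right fun hK => pairRank_eq_two_iff hV (hD.mono hK)
  have hdisj : Disjoint (D.powersetCard 2) (triangles D) := by
    rw [Finset.disjoint_left]
    intro K h2 h3
    have := (mem_triangles.1 h3).2.card_eq
    have := (Finset.mem_powersetCard.1 h2).2
    omega
  rw [h, Finset.sum_union hdisj]
  congr 1
  · refine Finset.sum_congr rfl fun K hK => ?_
    obtain ⟨hK, h2⟩ := Finset.mem_powersetCard.1 hK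
    rw [(pairRank_eq_two_iff hV (hD.mono hK)).2 (Or.inl h2), h2, Nat.sub_self, pow_zero, one_mul]
  · refine Finset.sum_congr rfl fun K hK => ?_
    obtain ⟨hK, h3⟩ := mem_triangles.1 hK
    rw [(pairRank_eq_two_iff hV (hD.mono hK)).2 (Or.inr h3), h3.card_eq, pow_one]

lemma sum_pairRank_eq_two_coeff_zero (hV : V.Finite) (hD : IsPairSet V D)
    (hS : ∀ d ∈ D, (S d).coeff 0 = 1) :
    ∑ K ∈ D.powerset.filter (fun K : Finset (Sym2 α) => pairRank V K = 2),
      ((X - 1 : ℤ[X]) ^ (#K - pairRank V ↑K) * ∏ d ∈ K, S d).coeff 0 =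
      ((#D).choose 2 : ℤ) - #(triangles D) := by
  classical
  rw [sum_pairRank_eq_two S hV hD]
  have h1 : ∀ K ∈ D.powersetCard 2, (∏ d ∈ K, S d).coeff 0 = 1 := fun K hK =>
    coeff_zero_prod_eq_one S K fun d hd => hS d ((Finset.mem_powersetCard.1 hK).1 hd)
  have h2 : ∀ K ∈ triangles D, ((X - 1) * ∏ d ∈ K, S d).coeff 0 = -1 := fun K hK => by
    rw [mul_coeff_zero,
      coeff_zero_prod_eq_one S K fun d hd => hS d ((mem_triangles.1 hK).1 hd)]
    simp
  rw [Finset.sum_congr rfl h1, Finset.sum_congr rfl h2]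
  simp [sub_eq_add_neg]

/-- A pair of edges contributes its number of nontrivial classes, a triangle contributes one minus
that number. For each class `d`, there are `#D - 1` pairs that contain `d`. -/
lemma sum_pairRank_eq_two_coeff_one [DecidableEq α] (hV : V.Finite) (hD : IsPairSet V D)
    (hS : ∀ d ∈ D, (S d).coeff 0 = 1) :
    ∑ K ∈ D.powerset.filter (fun K : Finset (Sym2 α) => pairRank V K = 2),
      ((X - 1 : ℤ[X]) ^ (#K - pairRank V ↑K) * ∏ d ∈ K, S d).coeff 1 =
      ∑ d ∈ D, (S d).coeff 1 * ((#D : ℤ) - 1 - #{K ∈ triangles D | d ∈ K}) +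
        #(triangles D) := by
  rw [sum_pairRank_eq_two S hV hD]
  have h1 : ∀ K ∈ D.powersetCard 2, (∏ d ∈ K, S d).coeff 1 = ∑ d ∈ K, (S d).coeff 1 :=
    fun K hK => coeff_one_prod_eq_sum S K
      fun d hd => hS d ((Finset.mem_powersetCard.1 hK).1 hd)
  have h2 : ∀ K ∈ triangles D,
      ((X - 1) * ∏ d ∈ K, S d).coeff 1 = 1 - ∑ d ∈ K, (S d).coeff 1 := fun K hK => by
    have hK' : ∀ d ∈ K, (S d).coeff 0 = 1 := fun d hd => hS d ((mem_triangles.1 hK).1 hd)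
    rw [mul_coeff_one, coeff_zero_prod_eq_one S K hK', coeff_one_prod_eq_sum S K hK']
    simp [coeff_one]
    ring
  have h3 : ∑ K ∈ triangles D, ∑ d ∈ K, (S d).coeff 1 =
      ∑ d ∈ D, (S d).coeff 1 * (#{K ∈ triangles D | d ∈ K} : ℤ) := by
    rw [Finset.sum_comm' (t' := D) (s' := fun d => {K ∈ triangles D | d ∈ K})]
    · refine Finset.sum_congr rfl fun d _ => ?_
      rw [Finset.sum_const, nsmul_eq_mul, mul_comm]
    · intro K d
      rw [Finset.mem_filter]
      exact ⟨fun h => ⟨h, (mem_triangles.1 h.1).1 h.2⟩, fun h => h.1⟩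
  rw [Finset.sum_congr rfl h1, Finset.sum_congr rfl h2, sum_powersetCard_two_sum,
    Finset.sum_sub_distrib, h3]
  simp only [mul_sub, Finset.sum_sub_distrib]
  simp
  ring

/-- Triangles through `s(x, y)` correspond to common neighbours of `x` and `y`. -/
lemma card_triangles_mem [DecidableEq α] {x y : α} (hD : IsPairSet V D) (hxy : s(x, y) ∈ D)
    (W : Finset α) (hW : ∀ w, w ∈ W ↔ s(x, w) ∈ D ∧ s(y, w) ∈ D) :
    #{K ∈ triangles D | s(x, y) ∈ K} = #W := by
  have hne : x ≠ y := (hD x y hxy).2.2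
  symm
  refine Finset.card_bij (fun w _ => {s(x, y), s(x, w), s(y, w)}) ?_ ?_ ?_
  · intro w hw
    obtain ⟨h1, h2⟩ := (hW w).1 hw
    rw [Finset.mem_filter, mem_triangles]
    refine ⟨⟨?_, x, y, w, hne, (hD x w h1).2.2, (hD y w h2).2.2, rfl⟩, by simp⟩
    intro z hz
    simp only [Finset.mem_insert, Finset.mem_singleton] at hz
    rcases hz with rfl | rfl | rfl <;> assumption
  · intro w hw v hv h
    have h1 := (hD x w ((hW w).1 hw).1).2.2
    have h2 := (hD y w ((hW w).1 hw).2).2.2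
    have : s(x, w) ∈ ({s(x, y), s(x, v), s(y, v)} : Finset (Sym2 α)) := h ▸ (by simp)
    simp only [Finset.mem_insert, Finset.mem_singleton, Sym2.eq_iff] at this
    grind
  · intro K hK
    rw [Finset.mem_filter, mem_triangles] at hK
    obtain ⟨⟨hKD, a, b, c, hab, hac, hbc, rfl⟩, hm⟩ := hK
    have m1 : s(a, b) ∈ D := hKD (by simp)
    have m2 : s(a, c) ∈ D := hKD (by simp)
    have m3 : s(b, c) ∈ D := hKD (by simp)
    have s1 := @Sym2.eq_swap α a b
    have s2 := @Sym2.eq_swap α a c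
    have s3 := @Sym2.eq_swap α b c
    simp only [Finset.mem_insert, Finset.mem_singleton, Sym2.eq_iff] at hm
    rcases hm with (⟨rfl, rfl⟩ | ⟨rfl, rfl⟩) | (⟨rfl, rfl⟩ | ⟨rfl, rfl⟩) | ⟨rfl, rfl⟩ | ⟨rfl, rfl⟩
    · exact ⟨c, (hW _).2 ⟨m2, m3⟩, rfl⟩
    · exact ⟨c, (hW _).2 ⟨m3, m2⟩,
        by ext z; simp only [Finset.mem_insert, Finset.mem_singleton]; grind⟩
    · exact ⟨b, (hW _).2 ⟨m1, s3 ▸ m3⟩,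
        by ext z; simp only [Finset.mem_insert, Finset.mem_singleton]; grind⟩
    · exact ⟨b, (hW _).2 ⟨s3 ▸ m3, m1⟩,
        by ext z; simp only [Finset.mem_insert, Finset.mem_singleton]; grind⟩
    · exact ⟨a, (hW _).2 ⟨s1 ▸ m1, s2 ▸ m2⟩,
        by ext z; simp only [Finset.mem_insert, Finset.mem_singleton]; grind⟩
    · exact ⟨a, (hW _).2 ⟨s2 ▸ m2, s1 ▸ m1⟩,
        by ext z; simp only [Finset.mem_insert, Finset.mem_singleton]; grind⟩

end SmallRank

/-! ### The pairs of ends of the edges of a multigraph -/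

namespace Graph

variable {α β : Type*} {G : Graph α β} {f : β → Sym2 α}

/-- `f` maps each edge of `G` to the unordered pair of its ends. The values of `f` at other
elements of `β` do not matter. -/
def IsEndsMap (G : Graph α β) (f : β → Sym2 α) : Prop :=
  ∀ e x y, G.IsLink e x y ↔ e ∈ G.edgeSet ∧ f e = s(x, y)

lemma exists_isEndsMap [Nonempty α] (G : Graph α β) : ∃ f, G.IsEndsMap f := by
  classical
  have h : ∀ e, ∃ d : Sym2 α, ∀ x y, G.IsLink e x y ↔ e ∈ G.edgeSet ∧ d = s(x, y) := by
    intro e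
    by_cases he : e ∈ G.edgeSet
    · obtain ⟨u, v, huv⟩ := G.exists_isLink_of_mem_edgeSet he
      exact ⟨s(u, v), fun x y => by rw [huv.isLink_iff_sym2_eq]; simp [he]⟩
    · obtain ⟨a⟩ := ‹Nonempty α›
      exact ⟨s(a, a), fun x y => by simp [he]⟩
  choose f hf using h
  exact ⟨f, hf⟩

namespace IsEndsMap

lemma adj_iff (hf : G.IsEndsMap f) {x y : α} : G.Adj x y ↔ s(x, y) ∈ f '' G.edgeSet := by
  simp only [Graph.Adj, hf _ x y, Set.mem_image]

lemma isPairSet (hf : G.IsEndsMap f) (hloop : G.Loopless) :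
    IsPairSet G.vertexSet (f '' G.edgeSet) := by
  intro a b hab
  have h : G.Adj a b := hf.adj_iff.2 hab
  exact ⟨h.left_mem, h.right_mem, h.ne⟩

lemma component_restrict (hf : G.IsEndsMap f) {A : Set β} (hA : A ⊆ G.edgeSet) :
    (G.restrict A).component = pairComp (f '' A) := by
  have h : (G.restrict A).Adj = fun a b => s(a, b) ∈ f '' A := by
    ext a b
    simp only [Graph.Adj, Graph.restrict_isLink, hf _ a b, Set.mem_image]
    exact exists_congr fun e => ⟨fun h => ⟨h.1, h.2.2⟩, fun h => ⟨h.1, hA h.1, h.2⟩⟩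
  ext x y
  simp only [Graph.component, pairComp, PairConn, h]

lemma edgeRank_eq (hf : G.IsEndsMap f) {A : Set β} (hA : A ⊆ G.edgeSet) :
    G.edgeRank A = pairRank G.vertexSet (f '' A) := by
  rw [edgeRank, numComponents, hf.component_restrict hA]
  rfl

lemma edgeRank_edgeSet (hf : G.IsEndsMap f) (hconn : G.IsConnected) :
    G.edgeRank G.edgeSet = G.vertexSet.ncard - 1 := by
  rw [hf.edgeRank_eq subset_rfl, pairRank, pairComps]
  obtain ⟨⟨x, hx⟩, hc⟩ := hconn
  have h : pairComp (f '' G.edgeSet) '' G.vertexSet = {pairComp (f '' G.edgeSet) x} := by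
    have h' : ∀ y ∈ G.vertexSet,
        pairComp (f '' G.edgeSet) y = pairComp (f '' G.edgeSet) x := by
      intro y hy
      rw [pairComp_eq_iff]
      have := hc y hy x hx
      rw [← G.restrict_self, hf.component_restrict subset_rfl] at this
      exact this
    ext C
    simp only [Set.mem_image, Set.mem_singleton_iff]
    constructor
    · rintro ⟨y, hy, rfl⟩
      exact h' y hy
    · rintro rfl
      exact ⟨x, hx, rfl⟩
  rw [h, Set.ncard_singleton]

/-- The ends of an edge of `G / A` are the components of its ends in `G`. -/
lemma contract (hf : G.IsEndsMap f) (A : Set β) :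
    (G.contract A).IsEndsMap (fun e => (f e).map (G.restrict A).component) := by
  intro e a b
  have hE : (G.contract A).edgeSet = G.edgeSet \ A := rfl
  have hL : (G.contract A).IsLink e a b ↔ ∃ u v, (G.IsLink e u v ∧ e ∉ A) ∧
      (G.restrict A).component u = a ∧ (G.restrict A).component v = b := Iff.rfl
  rw [hE, hL]
  constructor
  · rintro ⟨u, v, ⟨huv, heA⟩, rfl, rfl⟩
    refine ⟨⟨huv.edge_mem, heA⟩, ?_⟩
    simp only [((hf e u v).1 huv).2, Sym2.map_mk]
  · rintro ⟨⟨he, heA⟩, h⟩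
    obtain ⟨u, v, huv⟩ := G.exists_isLink_of_mem_edgeSet he
    simp only [((hf e u v).1 huv).2, Sym2.map_mk, Sym2.eq_iff] at h
    rcases h with ⟨rfl, rfl⟩ | ⟨rfl, rfl⟩
    · exact ⟨u, v, ⟨huv, heA⟩, rfl, rfl⟩
    · exact ⟨v, u, ⟨huv.symm, heA⟩, rfl, rfl⟩

/-! ### Parallel classes -/

lemma parallelClasses_eq (hf : G.IsEndsMap f) :
    G.parallelClasses = (fun d => {e ∈ G.edgeSet | f e = d}) '' (f '' G.edgeSet) := by
  ext A
  simp only [parallelClasses, Set.mem_ofPred_eq]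
  constructor
  · rintro ⟨x, y, hxy, rfl⟩
    refine ⟨s(x, y), hf.adj_iff.1 hxy, ?_⟩
    ext e
    exact (hf e x y).symm
  · rintro ⟨d, hd, rfl⟩
    induction d with | _ x y =>
    refine ⟨x, y, hf.adj_iff.2 hd, ?_⟩
    ext e
    exact (hf e x y).symm

/-- Distinct pairs of ends have distinct parallel classes, as these are nonempty. -/
lemma injOn_fiber (E : Set β) (f : β → Sym2 α) :
    Set.InjOn (fun d => {e ∈ E | f e = d}) (f '' E) := by
  rintro _ ⟨e, he, rfl⟩ d _ h
  exact ((Set.ext_iff.1 h e).1 ⟨he, rfl⟩).2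

lemma numParallelClasses_eq (hf : G.IsEndsMap f) :
    G.numParallelClasses = (f '' G.edgeSet).ncard := by
  rw [numParallelClasses, hf.parallelClasses_eq, (injOn_fiber _ f).ncard_image]

lemma coe_image_toFinset [DecidableEq α] (hE : G.edgeSet.Finite) :
    ((hE.toFinset.image f : Finset (Sym2 α)) : Set (Sym2 α)) = f '' G.edgeSet := by
  simp

variable [DecidableEq α]

lemma nontrivialParallelClasses_eq (hf : G.IsEndsMap f) (hE : G.edgeSet.Finite) :
    G.nontrivialParallelClasses = (fun d => {e ∈ G.edgeSet | f e = d}) ''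
      ({d ∈ hE.toFinset.image f | 2 ≤ #{e ∈ hE.toFinset | f e = d}} : Finset (Sym2 α)) := by
  have hnt : ∀ d, {e ∈ G.edgeSet | f e = d}.Nontrivial ↔ 2 ≤ #{e ∈ hE.toFinset | f e = d} := by
    intro d
    have : {e ∈ G.edgeSet | f e = d} = (({e ∈ hE.toFinset | f e = d} : Finset β) : Set β) := by
      ext e; simp
    rw [this, Finset.nontrivial_coe, ← Finset.one_lt_card_iff_nontrivial]
    rfl
  ext A
  simp only [nontrivialParallelClasses, hf.parallelClasses_eq, Set.mem_ofPred_eq]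
  constructor
  · rintro ⟨⟨d, hd, rfl⟩, hA⟩
    refine ⟨d, ?_, rfl⟩
    rw [Finset.mem_coe, Finset.mem_filter]
    refine ⟨?_, (hnt d).1 hA⟩
    rw [← Finset.mem_coe, coe_image_toFinset]
    exact hd
  · rintro ⟨d, hd, rfl⟩
    rw [Finset.mem_coe, Finset.mem_filter, ← Finset.mem_coe, coe_image_toFinset] at hd
    exact ⟨⟨d, hd.1, rfl⟩, (hnt d).2 hd.2⟩

lemma injOn_fiber_filter (hE : G.edgeSet.Finite) (p : Sym2 α → Prop) [DecidablePred p] :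
    Set.InjOn (fun d => {e ∈ G.edgeSet | f e = d})
      ({d ∈ hE.toFinset.image f | p d} : Finset (Sym2 α)) := by
  refine (injOn_fiber G.edgeSet f).mono ?_
  rw [← coe_image_toFinset hE]
  exact Finset.coe_subset.2 (Finset.filter_subset _ _)

lemma numNontrivialParallelClasses_eq (hf : G.IsEndsMap f) (hE : G.edgeSet.Finite) :
    G.numNontrivialParallelClasses =
      #{d ∈ hE.toFinset.image f | 2 ≤ #{e ∈ hE.toFinset | f e = d}} := by
  rw [numNontrivialParallelClasses, hf.nontrivialParallelClasses_eq hE,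
    (injOn_fiber_filter hE _).ncard_image, Set.ncard_coe_finset]

lemma finsum_nontrivialParallelClasses (hf : G.IsEndsMap f) (hE : G.edgeSet.Finite)
    (g : Set β → ℤ) :
    ∑ᶠ A ∈ G.nontrivialParallelClasses, g A =
      ∑ d ∈ hE.toFinset.image f with 2 ≤ #{e ∈ hE.toFinset | f e = d},
        g {e ∈ G.edgeSet | f e = d} := by
  rw [hf.nontrivialParallelClasses_eq hE, finsum_mem_image (injOn_fiber_filter hE _),
    finsum_mem_coe_finset]

/-! ### Contraction of a parallel class -/

/-- Identifying the ends `x` and `y` of an edge of a simple graph merges the edges from `x` and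
from `y` to each common neighbour, and no others. -/
lemma card_image_map_add {γ : Type*} [DecidableEq γ] {V : Set α} {D : Finset (Sym2 α)}
    (hD : IsPairSet V D) {x y : α} (hxy : s(x, y) ∈ D) (c : α → γ)
    (hc : ∀ u v, c u = c v ↔ u = v ∨ (u = x ∧ v = y) ∨ (u = y ∧ v = x))
    (W : Finset α) (hW : ∀ w, w ∈ W ↔ s(x, w) ∈ D ∧ s(y, w) ∈ D) :
    #((D.erase s(x, y)).image (Sym2.map c)) + #W + 1 = #D := by
  have hne : ∀ {a b}, s(a, b) ∈ D → a ≠ b := fun h => (hD _ _ h).2.2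
  set D₂ := D.erase s(x, y) \ W.image (fun w => s(y, w)) with hD₂
  have hsub : W.image (fun w => s(y, w)) ⊆ D.erase s(x, y) := by
    intro z hz
    obtain ⟨w, hw, rfl⟩ := Finset.mem_image.1 hz
    obtain ⟨h1, h2⟩ := (hW w).1 hw
    refine Finset.mem_erase.2 ⟨?_, h2⟩
    have := hne h1
    have := hne h2
    rw [Ne, Sym2.eq_iff]
    grind
  have hmem : ∀ a b, s(a, b) ∈ D₂ ↔
      (s(a, b) ∈ D ∧ ¬ ((a = x ∧ b = y) ∨ (a = y ∧ b = x))) ∧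
        ∀ w, s(x, w) ∈ D → s(y, w) ∈ D → ¬ ((a = y ∧ b = w) ∨ (a = w ∧ b = y)) := by
    intro a b
    simp only [hD₂, Finset.mem_sdiff, Finset.mem_erase, Finset.mem_image, hW, Ne, Sym2.eq_iff]
    grind
  have himg : (D.erase s(x, y)).image (Sym2.map c) = D₂.image (Sym2.map c) := by
    refine Finset.Subset.antisymm ?_ (Finset.image_subset_image Finset.sdiff_subset)
    intro z hz
    obtain ⟨d, hd, rfl⟩ := Finset.mem_image.1 hz
    by_cases hdW : d ∈ W.image (fun w => s(y, w))
    · obtain ⟨w, hw, rfl⟩ := Finset.mem_image.1 hdW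
      obtain ⟨h1, h2⟩ := (hW w).1 hw
      refine Finset.mem_image.2 ⟨s(x, w), ?_, ?_⟩
      · rw [hmem]
        have := hne h1
        have := hne h2
        have := hne hxy
        grind
      · rw [Sym2.map_mk, Sym2.map_mk, (hc x y).2 (by simp)]
    · exact Finset.mem_image_of_mem _ (Finset.mem_sdiff.2 ⟨hd, hdW⟩)
  have hinj : Set.InjOn (Sym2.map c) (D₂ : Set (Sym2 α)) := by
    -- It suffices to treat the case where `c` identifies the ends in the given order.
    have aux : ∀ u v u' v', s(u, v) ∈ D₂ → s(u', v') ∈ D₂ → c u = c u' → c v = c v' →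
        u = u' ∧ v = v' := by
      intro u v u' v' h h' h1 h2
      rw [hmem] at h h'
      rw [hc] at h1 h2
      have e1 := hne h.1.1
      have e2 := hne h'.1.1
      have s1 := @Sym2.eq_swap α u v
      have s2 := @Sym2.eq_swap α u' v'
      grind
    intro d hd d' hd' h
    rw [Finset.mem_coe] at hd hd'
    induction d with | _ u v =>
    induction d' with | _ u' v' =>
    rw [Sym2.map_mk, Sym2.map_mk, Sym2.eq_iff] at h
    rcases h with ⟨h1, h2⟩ | ⟨h1, h2⟩
    · obtain ⟨rfl, rfl⟩ := aux _ _ _ _ hd hd' h1 h2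
      rfl
    · rw [Sym2.eq_swap] at hd'
      obtain ⟨rfl, rfl⟩ := aux _ _ _ _ hd hd' h1 h2
      exact Sym2.eq_swap
  have hW' : #(W.image fun w => s(y, w)) = #W :=
    Finset.card_image_of_injective _ fun a b h => Sym2.congr_right.1 h
  rw [himg, Finset.card_image_of_injOn hinj, hD₂, Finset.card_sdiff_of_subset hsub, hW']
  have h1 := Finset.card_le_card hsub
  have h2 := Finset.card_erase_add_one hxy
  omega

/-- Contracting the class of `d` removes it and merges two other classes precisely if they form a
triangle with `d`. -/
lemma numParallelClasses_contract (hf : G.IsEndsMap f) (hE : G.edgeSet.Finite)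
    (hloop : G.Loopless) {d : Sym2 α} (hd : d ∈ hE.toFinset.image f) :
    ((G.contract {e ∈ G.edgeSet | f e = d}).numParallelClasses : ℤ) =
      #(hE.toFinset.image f) - 1 - #{K ∈ triangles (hE.toFinset.image f) | d ∈ K} := by
  classical
  induction d with | _ x y =>
  set D := hE.toFinset.image f with hDdef
  have hDc : (D : Set (Sym2 α)) = f '' G.edgeSet := coe_image_toFinset hE
  have hD : IsPairSet G.vertexSet D := hDc ▸ hf.isPairSet hloop
  set A : Set β := {e ∈ G.edgeSet | f e = s(x, y)} with hA
  have hAE : A ⊆ G.edgeSet := Set.sep_subset _ _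
  have hfA : f '' A = {s(x, y)} := by
    ext z
    simp only [hA, Set.mem_image, Set.mem_singleton_iff]
    constructor
    · rintro ⟨e, he, rfl⟩
      exact he.2
    · rintro rfl
      have : s(x, y) ∈ f '' G.edgeSet := hDc ▸ Finset.mem_coe.2 hd
      obtain ⟨e, he, hexy⟩ := this
      exact ⟨e, ⟨he, hexy⟩, hexy⟩
  have hcomp : ∀ u v, (G.restrict A).component u = (G.restrict A).component v ↔
      u = v ∨ (u = x ∧ v = y) ∨ (u = y ∧ v = x) := by
    intro u v
    rw [hf.component_restrict hAE, hfA, pairComp_eq_iff, pairConn_singleton_iff]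
    grind
  obtain ⟨W, hW⟩ : ∃ W : Finset α, ∀ w, w ∈ W ↔ s(x, w) ∈ D ∧ s(y, w) ∈ D := by
    have hfin : {w | s(x, w) ∈ D ∧ s(y, w) ∈ D}.Finite :=
      (D.finite_toSet.preimage (f := fun w => s(x, w))
        fun a _ b _ h => Sym2.congr_right.1 h).subset fun w hw => hw.1
    exact ⟨hfin.toFinset, fun w => by simp⟩
  have hcard := card_image_map_add hD hd _ hcomp W hW
  rw [card_triangles_mem hD hd W hW, (hf.contract A).numParallelClasses_eq]
  have himg : (fun e => (f e).map (G.restrict A).component) '' (G.contract A).edgeSet =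
      ((D.erase s(x, y)).image (Sym2.map (G.restrict A).component) : Finset _) := by
    have hE' : (G.contract A).edgeSet = G.edgeSet \ A := rfl
    rw [hE', Finset.coe_image, Finset.coe_erase, hDc, ← Set.image_image (Sym2.map _) f]
    congr 1
    ext z
    simp only [hA, Set.mem_image, Set.mem_sdiff, Set.mem_ofPred_eq, Set.mem_singleton_iff]
    constructor
    · rintro ⟨e, ⟨he, hn⟩, rfl⟩
      exact ⟨⟨e, he, rfl⟩, fun h => hn ⟨he, h⟩⟩
    · rintro ⟨⟨e, he, rfl⟩, hn⟩
      exact ⟨e, ⟨he, fun h => hn h.2⟩, rfl⟩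
  rw [himg, Set.ncard_coe_finset]
  omega

/-! ### Triangles -/

lemma numTriangles_eq (hf : G.IsEndsMap f) (hE : G.edgeSet.Finite) (hloop : G.Loopless) :
    G.numTriangles = #(triangles (hE.toFinset.image f)) := by
  classical
  set D := hE.toFinset.image f with hDdef
  have hDc : (D : Set (Sym2 α)) = f '' G.edgeSet := coe_image_toFinset hE
  have hD : IsPairSet G.vertexSet D := hDc ▸ hf.isPairSet hloop
  have hadj : ∀ a b : G.vertexSet, G.toSimpleGraph.Adj a b ↔ s((a : α), (b : α)) ∈ D := by
    intro a b
    rw [toSimpleGraph_adj_iff, hf.adj_iff, ← hDc, Finset.mem_coe]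
  -- A clique on three vertices corresponds to the set of pairs inside it.
  set φ : Finset G.vertexSet → Finset (Sym2 α) := fun t =>
    {d ∈ D | ∀ v ∈ d, ∃ w ∈ t, (w : α) = v} with hφ
  have hφ3 : ∀ a b c : G.vertexSet, s((a : α), (b : α)) ∈ D → s((a : α), (c : α)) ∈ D →
      s((b : α), (c : α)) ∈ D →
      φ {a, b, c} = {s((a : α), (b : α)), s((a : α), (c : α)), s((b : α), (c : α))} := by
    intro a b c hab hac hbc
    ext d
    induction d with | _ u v =>
    simp only [hφ, Finset.mem_filter, Finset.mem_insert, Finset.mem_singleton, Sym2.mem_iff,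
      forall_eq_or_imp, forall_eq, exists_eq_or_imp, exists_eq_left]
    constructor
    · rintro ⟨huv, hu, hv⟩
      have := (hD _ _ huv).2.2
      simp only [Sym2.eq_iff]
      grind
    · have s1 := @Sym2.eq_swap α a b
      have s2 := @Sym2.eq_swap α a c
      have s3 := @Sym2.eq_swap α b c
      rintro (h | h | h) <;> refine ⟨h ▸ ‹_›, ?_⟩ <;> rw [Sym2.eq_iff] at h <;> grind
  rw [numTriangles, ← Set.ncard_coe_finset]
  refine Set.ncard_congr (fun t _ => φ t) ?_ ?_ ?_
  · intro t ht
    obtain ⟨a, b, c, hab, hac, hbc, rfl⟩ :=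
      SimpleGraph.is3Clique_iff.1 ((SimpleGraph.mem_cliqueSet_iff).1 ht)
    rw [hadj] at hab hac hbc
    rw [Finset.mem_coe, mem_triangles]
    refine ⟨Finset.filter_subset _ _, a, b, c, (hD _ _ hab).2.2, (hD _ _ hac).2.2,
      (hD _ _ hbc).2.2, hφ3 a b c hab hac hbc⟩
  · have hrec : ∀ t ∈ G.toSimpleGraph.cliqueSet 3, ∀ v : G.vertexSet,
        v ∈ t ↔ ∃ d ∈ φ t, (v : α) ∈ d := by
      intro t ht v
      obtain ⟨a, b, c, hab, hac, hbc, rfl⟩ :=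
        SimpleGraph.is3Clique_iff.1 ((SimpleGraph.mem_cliqueSet_iff).1 ht)
      rw [hadj] at hab hac hbc
      rw [hφ3 a b c hab hac hbc]
      simp only [Finset.mem_insert, Finset.mem_singleton, exists_eq_or_imp, exists_eq_left,
        Sym2.mem_iff, Subtype.ext_iff]
      tauto
    intro t t' ht ht' h
    have h : φ t = φ t' := h
    ext v
    rw [hrec t ht, hrec t' ht', h]
  · intro K hK
    rw [Finset.mem_coe, mem_triangles] at hK
    obtain ⟨hKD, a, b, c, -, -, -, rfl⟩ := hK
    have hab : s(a, b) ∈ D := hKD (by simp)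
    have hac : s(a, c) ∈ D := hKD (by simp)
    have hbc : s(b, c) ∈ D := hKD (by simp)
    let a' : G.vertexSet := ⟨a, (hD _ _ hab).1⟩
    let b' : G.vertexSet := ⟨b, (hD _ _ hab).2.1⟩
    let c' : G.vertexSet := ⟨c, (hD _ _ hac).2.1⟩
    refine ⟨{a', b', c'}, ?_, hφ3 a' b' c' hab hac hbc⟩
    rw [SimpleGraph.mem_cliqueSet_iff, SimpleGraph.is3Clique_iff]
    exact ⟨a', b', c', (hadj _ _).2 hab, (hadj _ _).2 hac, (hadj _ _).2 hbc, rfl⟩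

end IsEndsMap

end Graph

/-! ### The coefficients of the Tutte polynomial -/

namespace Graph

variable {α β : Type*} {G : Graph α β} {f : β → Sym2 α}

open Polynomial in
/-- In each summand of the Tutte polynomial, the variables `x` and `y` are separated. -/
lemma coeff_coeff_tuttePoly (hE : G.edgeSet.Finite) (i j : ℕ) :
    (G.tuttePoly.coeff j).coeff i =
      ∑ A ∈ hE.toFinset.powerset,
        ((X - 1 : ℤ[X]) ^ (G.edgeRank G.edgeSet - G.edgeRank A)).coeff i *
          ((X - 1 : ℤ[X]) ^ G.edgeNullity A).coeff j := by
  have hset : {A : Set β | A ⊆ G.edgeSet} =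
      (fun A : Finset β => (A : Set β)) '' (hE.toFinset.powerset : Finset (Finset β)) := by
    ext A
    simp only [Set.mem_ofPred_eq, Set.mem_image, Finset.mem_coe, Finset.mem_powerset]
    constructor
    · intro hA
      refine ⟨(hE.subset hA).toFinset, ?_, by simp⟩
      simpa using hA
    · rintro ⟨B, hB, rfl⟩
      simpa using Finset.coe_subset.2 hB
  rw [tuttePoly, hset, finsum_mem_image (Finset.coe_injective.injOn), finsum_mem_coe_finset,
    finsetSum_coeff, finsetSum_coeff]
  refine Finset.sum_congr rfl fun A _ => ?_
  have h1 : ∀ a, (C X - 1 : ℤ[X][X]) ^ a = C ((X - 1) ^ a) := by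
    intro a; simp
  have h2 : ∀ b, (X - 1 : ℤ[X][X]) ^ b = ((X - 1 : ℤ[X]) ^ b).map C := by
    intro b; simp
  rw [h1, h2, coeff_C_mul, coeff_map, coeff_mul_C]

namespace IsEndsMap

open Polynomial in
/-- The coefficient of `x ^ (n - 1 - k)` in terms of the sets `K` of pairs of ends of rank at most
`k`. Each such set is weighted by the sum over all edge sets that realize exactly these pairs. -/
lemma tutteCoeff_eq [DecidableEq α] [DecidableEq β] (hf : G.IsEndsMap f)
    (hV : G.vertexSet.Finite) (hE : G.edgeSet.Finite)
    (hconn : G.IsConnected) (hloop : G.Loopless) {k : ℕ} (hk : k ≤ G.vertexSet.ncard - 1)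
    (j : ℕ) :
    G.tutteCoeff ((G.vertexSet.ncard - 1 - k : ℕ) : ℤ) j =
      ∑ l ∈ range (k + 1), (-1) ^ (k - l) *
        ((G.vertexSet.ncard - 1 - l).choose (k - l) : ℤ) *
        ∑ K ∈ (hE.toFinset.image f).powerset.filter
            (fun K : Finset (Sym2 α) => pairRank G.vertexSet K = l),
          ((X - 1 : ℤ[X]) ^ (#K - pairRank G.vertexSet K) *
            ∏ d ∈ K, ∑ i ∈ range #{e ∈ hE.toFinset | f e = d}, X ^ i).coeff j := by
  have hDc : ((hE.toFinset.image f : Finset (Sym2 α)) : Set (Sym2 α)) = f '' G.edgeSet :=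
    coe_image_toFinset hE
  have hD : IsPairSet G.vertexSet (hE.toFinset.image f : Finset (Sym2 α)) :=
    hDc ▸ hf.isPairSet hloop
  have hsub : ∀ K ∈ (hE.toFinset.image f).powerset,
      (K : Set (Sym2 α)) ⊆ f '' G.edgeSet := fun K hK =>
    hDc ▸ Finset.coe_subset.2 (Finset.mem_powerset.1 hK)
  have hrE := hf.edgeRank_edgeSet hconn
  rw [← sum_coeff_mul_eq_sum_range _ (fun K : Finset (Sym2 α) => pairRank G.vertexSet K) _ k hk,
    ← sum_powerset_eq_sum_powerset_image hE.toFinset f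
      (fun K : Finset (Sym2 α) => pairRank G.vertexSet K)
      (fun K hK => pairRank_le_card hV K (hD.mono (Finset.coe_subset.2 hK)))
      (fun ρ => ((X - 1 : ℤ[X]) ^ (G.vertexSet.ncard - 1 - ρ)).coeff
        (G.vertexSet.ncard - 1 - k)) j]
  · rw [tutteCoeff, if_pos ⟨by positivity, by positivity⟩, Int.toNat_natCast, Int.toNat_natCast,
      coeff_coeff_tuttePoly hE]
    refine Finset.sum_congr rfl fun A hA => ?_
    have hA' : (A : Set β) ⊆ G.edgeSet := by
      simpa using Finset.coe_subset.2 (Finset.mem_powerset.1 hA)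
    rw [edgeNullity, hrE, hf.edgeRank_eq hA', Set.ncard_coe_finset, Finset.coe_image]
  · intro K hK
    rw [← hrE, hf.edgeRank_eq subset_rfl]
    exact pairRank_mono hV (hsub K hK)

end IsEndsMap

end Graph

open Polynomial in
lemma coeff_zero_sum_range_X_pow {m : ℕ} (hm : 1 ≤ m) :
    (∑ i ∈ range m, (X : ℤ[X]) ^ i).coeff 0 = 1 := by
  simp only [finsetSum_coeff, coeff_X_pow]
  rw [Finset.sum_ite_eq, if_pos (Finset.mem_range.2 hm)]

open Polynomial in
lemma coeff_one_sum_range_X_pow (m : ℕ) :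
    (∑ i ∈ range m, (X : ℤ[X]) ^ i).coeff 1 = if 2 ≤ m then 1 else 0 := by
  simp only [finsetSum_coeff, coeff_X_pow, Finset.sum_ite_eq, Finset.mem_range]
  rfl

theorem theorem2 {α β : Type*} (G : Graph α β)
    (hV : G.vertexSet.Finite) (hE : G.edgeSet.Finite)
    (hconn : G.IsConnected) (hloop : G.Loopless) (hbridge : G.Bridgeless)
    (n : ℕ) (hn : n = G.vertexSet.ncard) :
    G.tutteCoeff ((n : ℤ) - 1) 0 = 1 ∧
    G.tutteCoeff ((n : ℤ) - 2) 0 = (G.numParallelClasses : ℤ) - n + 1 ∧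
    G.tutteCoeff ((n : ℤ) - 3) 0 =
      ((n - 1).choose 2 : ℤ) - ((n : ℤ) - 2) * G.numParallelClasses
        + (G.numParallelClasses.choose 2 : ℤ) - G.numTriangles ∧
    G.tutteCoeff ((n : ℤ) - 2) 1 = G.numNontrivialParallelClasses ∧
    G.tutteCoeff ((n : ℤ) - 3) 1 =
      -(G.numNontrivialParallelClasses : ℤ) * ((n : ℤ) - 2)
        + ∑ᶠ A ∈ G.nontrivialParallelClasses, ((G.contract A).numParallelClasses : ℤ)
        + G.numTriangles := by
  classical
  obtain ⟨x, hx⟩ := hconn.1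
  have : Nonempty α := ⟨x⟩
  obtain ⟨f, hf⟩ := G.exists_isEndsMap
  have hn1 : 1 ≤ n := hn ▸ (Set.ncard_pos hV).2 ⟨x, hx⟩
  set D := hE.toFinset.image f with hDdef
  have hDc : (D : Set (Sym2 α)) = f '' G.edgeSet := Graph.IsEndsMap.coe_image_toFinset hE
  have hD : IsPairSet G.vertexSet D := hDc ▸ hf.isPairSet hloop
  set S : Sym2 α → Polynomial ℤ := fun d =>
    ∑ i ∈ range #{e ∈ hE.toFinset | f e = d}, Polynomial.X ^ i with hSdef
  have hS0 : ∀ d ∈ D, (S d).coeff 0 = 1 := by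
    intro d hd
    obtain ⟨e, he, rfl⟩ := Finset.mem_image.1 hd
    exact coeff_zero_sum_range_X_pow (Finset.card_pos.2 ⟨e, by simpa using he⟩)
  have hS1 : ∀ g : Sym2 α → ℤ, ∑ d ∈ D, (S d).coeff 1 * g d =
      ∑ d ∈ D with 2 ≤ #{e ∈ hE.toFinset | f e = d}, g d := by
    intro g
    simp only [hSdef, coeff_one_sum_range_X_pow, Finset.sum_filter, ite_mul, one_mul, zero_mul]
  -- The total weight of the sets of pairs of rank `l`, as a polynomial in `y`.
  set w : ℕ → ℕ → ℤ := fun l j =>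
    ∑ K ∈ D.powerset.filter (fun K : Finset (Sym2 α) => pairRank G.vertexSet K = l),
      ((Polynomial.X - 1 : Polynomial ℤ) ^ (#K - pairRank G.vertexSet K) *
        ∏ d ∈ K, S d).coeff j with hw
  have hp : G.numParallelClasses = #D := by
    rw [hf.numParallelClasses_eq, ← hDc, Set.ncard_coe_finset]
  have hw0 : ∀ j, w 0 j = if j = 0 then 1 else 0 := fun j => sum_pairRank_eq_zero S hV hD j
  have hw10 : w 1 0 = G.numParallelClasses := by
    refine (sum_pairRank_eq_one S hV hD 0).trans ?_
    rw [Finset.sum_congr rfl hS0, hp]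
    simp
  have hw11 : w 1 1 = G.numNontrivialParallelClasses := by
    refine (sum_pairRank_eq_one S hV hD 1).trans ?_
    have := hS1 fun _ => 1
    simp only [mul_one] at this
    rw [this, hf.numNontrivialParallelClasses_eq hE]
    simp [hDdef]
  have hw20 : w 2 0 = (G.numParallelClasses.choose 2 : ℤ) - G.numTriangles := by
    refine (sum_pairRank_eq_two_coeff_zero S hV hD hS0).trans ?_
    rw [hp, hf.numTriangles_eq hE hloop]
  have hw21 : w 2 1 = ∑ᶠ A ∈ G.nontrivialParallelClasses,
      ((G.contract A).numParallelClasses : ℤ) + G.numTriangles := by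
    refine (sum_pairRank_eq_two_coeff_one S hV hD hS0).trans ?_
    rw [hS1, hf.numTriangles_eq hE hloop, hf.finsum_nontrivialParallelClasses hE]
    congr 1
    refine Finset.sum_congr rfl fun d hd => ?_
    exact (hf.numParallelClasses_contract hE hloop (Finset.mem_filter.1 hd).1).symm
  -- Ranks are at most `n - 1`. This gives the formulas whose left-hand side is zero because of a
  -- negative exponent.
  have hwbig : ∀ l j, n - 1 < l → w l j = 0 := by
    intro l j hl
    refine Finset.sum_eq_zero fun K hK => ?_
    obtain ⟨hK, h⟩ := Finset.mem_filter.1 hK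
    have h1 := pairRank_mono hV (Finset.coe_subset.2 (Finset.mem_powerset.1 hK))
    rw [hDc, ← hf.edgeRank_eq subset_rfl, hf.edgeRank_edgeSet hconn, ← hn] at h1
    omega
  have key : ∀ k j : ℕ, k ≤ n - 1 → G.tutteCoeff ((n : ℤ) - (k + 1 : ℕ)) j =
      ∑ l ∈ range (k + 1), (-1) ^ (k - l) * ((n - 1 - l).choose (k - l) : ℤ) * w l j := by
    intro k j hk
    have h := hf.tutteCoeff_eq hV hE hconn hloop (k := k) (hn ▸ hk) j
    rw [← hn] at h
    rw [← h]
    congr 1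
    omega
  have hneg : ∀ i j : ℤ, i < 0 → G.tutteCoeff i j = 0 := by
    intro i j hi
    exact if_neg fun h => absurd h.1 (not_le.2 hi)
  have key1 : ∀ j : ℕ, G.tutteCoeff ((n : ℤ) - 2) j = w 1 j - ((n : ℤ) - 1) * w 0 j := by
    intro j
    rcases Nat.lt_or_ge (n - 1) 1 with h | h
    · obtain rfl : n = 1 := by omega
      rw [hneg _ _ (by norm_num), hwbig 1 j (by norm_num)]
      simp
    · have := key 1 j h
      simp only [Finset.sum_range_succ, Finset.sum_range_zero] at this
      norm_num at this
      rw [this, Nat.cast_sub hn1]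
      push_cast
      ring
  have key2 : ∀ j : ℕ, G.tutteCoeff ((n : ℤ) - 3) j =
      w 2 j - ((n : ℤ) - 2) * w 1 j + ((n - 1).choose 2 : ℤ) * w 0 j := by
    intro j
    rcases Nat.lt_or_ge (n - 1) 2 with h | h
    · rw [hneg _ _ (by omega), hwbig 2 j h, Nat.choose_eq_zero_of_lt h]
      obtain rfl | rfl : n = 1 ∨ n = 2 := by omega
      · rw [hwbig 1 j (by norm_num)]
        simp
      · simp
    · have := key 2 j h
      simp only [Finset.sum_range_succ, Finset.sum_range_zero] at this
      norm_num at this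
      rw [this, Nat.cast_sub (by omega), Nat.cast_sub hn1]
      push_cast
      ring
  refine ⟨?_, ?_, ?_, ?_, ?_⟩
  · have := key 0 0 (Nat.zero_le _)
    simpa [hw0] using this
  · have := key1 0
    rw [hw0, hw10] at this
    rw [Nat.cast_zero] at this
    rw [this]
    simp
    ring
  · have := key2 0
    rw [hw0, hw10, hw20] at this
    rw [Nat.cast_zero] at this
    rw [this]
    simp
    ring
  · have := key1 1
    rw [hw0, hw11] at this
    rw [Nat.cast_one] at this
    rw [this]
    simp
  · have := key2 1
    rw [hw0, hw11, hw21] at this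
    rw [Nat.cast_one] at this
    rw [this]
    simp
    ring
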